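/- Let $\mathcal M$ be an acyclic oriented matroid on a finite ground set $S$, given by its vectors, covectors, circuits and cocircuits, all of which are signed subsets $x=(x_+,x_-)$ of $S$ with support $\underline{x}=x_+\cup x_-$. Acyclic means that $(S,\varnothing)$ is a covector. A *face* of $\mathcal M$ is a set $F\subseteq S$ such that $(S\smallsetminus F,\varnothing)$ is a covector. The faces ordered by inclusion form the Las Vergnas face lattice $\mathrm{FL}(\mathcal M)$. **Building sets.** Let $\mathcal B$ be a set of nonempty subsets of $S$ that contains all singletons, contains $B\cup B'$ whenever $B,B'\in\mathcal B$ and $B\cap B'\neq\varnothing$, and contains the support of every circuit of $\mathcal M$. In other words, $(\mathcal B,\mathcal M)$ is an oriented building set. For a subset $\mathcal X$ of a poset, let $\kappa(\mathcal X)$ be the set of maximal elements of $\mathcal X$. **Acyclic nested complex.** A *nested set* on $\mathcal B$ is a set $\mathcal N$ with $\kappa(\mathcal B)\subseteq\mathcal N\subseteq\mathcal B$ such that any two elements of $\mathcal N$ are either disjoint or comparable for inclusion, and such that no union of $k\ge 2$ pairwise disjoint elements of $\mathcal N$ is in $\mathcal B$. It is *acyclic* for $\mathcal M$ if, for every $B\in\mathcal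 N$, the contraction of $\bigcup_{C\in\mathcal N,\,C\subsetneq B}C$ in the restriction $\mathcal M_{|B}$ is acyclic. The *acyclic nested complex* of $(\mathcal B,\mathcal M)$ has as faces the sets $\mathcal N\smallsetminus\kappa(\mathcal B)$, for all nested sets $\mathcal N$ on $\mathcal B$ that are acyclic for $\mathcal M$. **Facial nested complex.** For a finite lattice $L$ with bottom element $\hat 0$, an *$L$-building set* is a set $\mathcal F\subseteq L\smallsetminus\{\hat 0\}$ such that, for every $Y\neq\hat 0$ in $L$, there is a poset isomorphism $\prod_{X\in\kappa(\{B\in\mathcal F\,:\,B\le Y\})}[\hat 0,X]\to[\hat 0,Y]$ that restricts on each factor to the inclusion $[\hat 0,X]\subseteq[\hat 0,Y]$. An *$L$-nested set* on $\mathcal F$ is a set $\mathcal N$ with $\kappa(\mathcal F)\subseteq\mathcal N\subseteq\mathcal F$ such that no join of $k\ge2$ pairwise incomparable elements of $\mathcal N\smallsetminus\kappa(\mathcal F)$ is in $\mathcal F$. The *$L$-nested complex* of $\mathcal F$ has as faces the sets $\mathcal N\smallsetminus\kappa(\mathcal F)$, for all $L$-nested sets $\mathcal N$ on $\mathcal F$.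 For $L=\mathrm{FL}(\mathcal M)$ these are called facial building sets and facial nested complexes. **Theorem.** Let $\mathcal F=\mathcal B\cap\mathrm{FL}(\mathcal M)$. Then $\mathcal F$ is a facial building set for $\mathcal M$, and the facial nested complex of $(\mathcal F,\mathcal M)$ and the acyclic nested complex of $(\mathcal B,\mathcal M)$ coincide, that is, they have the same faces as collections of subsets of $S$. -/

import Mathlib

/-! ### Signed subsets -/

/-- A signed subset: a pair of disjoint finite sets. -/
@[ext]
structure SignedSubset (α : Type*) where
  pos : Finset α
  neg : Finset α
  disj : Disjoint pos neg

namespace SignedSubset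

variable {α : Type*} [DecidableEq α]

/-- The support `x₊ ∪ x₋`. -/
def supp (x : SignedSubset α) : Finset α := x.pos ∪ x.neg

/-- The opposite `(x₋, x₊)`. -/
def opp (x : SignedSubset α) : SignedSubset α := ⟨x.neg, x.pos, x.disj.symm⟩

/-- The nonnegative signed subset `(A, ∅)`. -/
def ofPos (A : Finset α) : SignedSubset α := ⟨A, ∅, Finset.disjoint_empty_right A⟩

/-- `x ∩ R = (x₊ ∩ R, x₋ ∩ R)`. -/
def inter (x : SignedSubset α) (R : Finset α) : SignedSubset α :=
  ⟨x.pos ∩ R, x.neg ∩ R,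
    x.disj.mono Finset.inter_subset_left Finset.inter_subset_left⟩

/-- `x ∖ R = (x₊ ∖ R, x₋ ∖ R)`. -/
def sdiff (x : SignedSubset α) (R : Finset α) : SignedSubset α :=
  ⟨x.pos \ R, x.neg \ R, x.disj.mono Finset.sdiff_subset Finset.sdiff_subset⟩

/-- Sign orthogonality. -/
def Orth (x y : SignedSubset α) : Prop :=
  ((x.pos ∩ y.pos) ∪ (x.neg ∩ y.neg)).Nonempty ↔
    ((x.pos ∩ y.neg) ∪ (x.neg ∩ y.pos)).Nonempty

/-- The signed subsets of `E` that are sign orthogonal to all elements of `X`. -/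
def perp (E : Finset α) (X : Set (SignedSubset α)) : Set (SignedSubset α) :=
  {y | y.supp ⊆ E ∧ ∀ x ∈ X, x.Orth y}

/-- The support-minimal elements of `X`, among those with nonempty support. -/
def suppMin (X : Set (SignedSubset α)) : Set (SignedSubset α) :=
  {x | x ∈ X ∧ x.supp.Nonempty ∧
    ∀ y ∈ X, y.supp.Nonempty → y.supp ⊆ x.supp → y.supp = x.supp}

end SignedSubset

/-! ### Oriented matroids -/

/-- Four sets of signed subsets on a finite ground set: the raw data of an oriented matroid. -/
structure SignedSystem (α : Type*) where
  ground : Finset α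
  vectors : Set (SignedSubset α)
  covectors : Set (SignedSubset α)
  circuits : Set (SignedSubset α)
  cocircuits : Set (SignedSubset α)

/-- An oriented matroid: the raw data, subject to the orthogonality and support-minimality
relations between the four sets and to the circuit axioms. -/
structure OrientedMatroid (α : Type*) [DecidableEq α] extends SignedSystem α where
  vectors_eq : vectors = SignedSubset.perp ground cocircuits
  covectors_eq : covectors = SignedSubset.perp ground circuits
  circuits_eq : circuits = SignedSubset.suppMin vectors
  cocircuits_eq : cocircuits = SignedSubset.suppMin covectors
  empty_notMem : SignedSubset.ofPos ∅ ∉ circuits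
  opp_mem : ∀ c ∈ circuits, c.opp ∈ circuits
  eq_or_eq_opp : ∀ c ∈ circuits, ∀ c' ∈ circuits, c.supp ⊆ c'.supp → c = c' ∨ c = c'.opp
  elimination : ∀ c ∈ circuits, ∀ c' ∈ circuits, c ≠ c'.opp → ∀ s ∈ c.pos ∩ c'.neg,
    ∃ c'' ∈ circuits, c''.pos ⊆ (c.pos ∪ c'.pos) \ {s} ∧ c''.neg ⊆ (c.neg ∪ c'.neg) \ {s}

namespace SignedSystem

variable {α : Type*} [DecidableEq α]

/-- The restriction of `M` to `R`, given by its vectors and covectors. -/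
def restrict (M : SignedSystem α) (R : Finset α) : SignedSystem α where
  ground := R
  vectors := {v | v ∈ M.vectors ∧ v.supp ⊆ R}
  covectors := (fun v => v.inter R) '' M.covectors
  circuits := SignedSubset.suppMin {v | v ∈ M.vectors ∧ v.supp ⊆ R}
  cocircuits := SignedSubset.suppMin ((fun v => v.inter R) '' M.covectors)

/-- The contraction of `R` in `M`, given by its vectors and covectors. -/
def contract (M : SignedSystem α) (R : Finset α) : SignedSystem α where
  ground := M.ground \ R
  vectors := (fun v => v.sdiff R) '' M.vectors
  covectors := {v | v ∈ M.covectors ∧ v.supp ∩ R = ∅}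
  circuits := SignedSubset.suppMin ((fun v => v.sdiff R) '' M.vectors)
  cocircuits := SignedSubset.suppMin {v | v ∈ M.covectors ∧ v.supp ∩ R = ∅}

/-- `M` is acyclic if the all-positive sign vector is a covector. -/
def Acyclic (M : SignedSystem α) : Prop := SignedSubset.ofPos M.ground ∈ M.covectors

/-- A face is the complement of a nonnegative covector. -/
def IsFace (M : SignedSystem α) (F : Finset α) : Prop :=
  F ⊆ M.ground ∧ SignedSubset.ofPos (M.ground \ F) ∈ M.covectors

end SignedSystem

namespace OrientedMatroid

variable {α : Type*} [DecidableEq α]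

/-- The Las Vergnas face lattice: the faces of `M`, ordered by inclusion. -/
abbrev FaceLattice (M : OrientedMatroid α) : Type _ := {F : Finset α // M.IsFace F}

theorem isFace_iff (M : OrientedMatroid α) (F : Finset α) :
    M.IsFace F ↔ F ⊆ M.ground ∧ ∀ c ∈ M.circuits,
      ((c.pos ∩ (M.ground \ F)).Nonempty ↔ (c.neg ∩ (M.ground \ F)).Nonempty) := by
  unfold SignedSystem.IsFace
  rw [M.covectors_eq]
  simp [SignedSubset.perp, SignedSubset.ofPos, SignedSubset.supp, SignedSubset.Orth]

open Classical in
/-- The smallest face of `M` containing `A ∩ M.ground`. -/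
noncomputable def faceClosure (M : OrientedMatroid α) (A : Finset α) : Finset α :=
  M.ground.filter fun x => ∀ F, M.IsFace F → A ⊆ F → x ∈ F

theorem mem_faceClosure (M : OrientedMatroid α) {A : Finset α} {x : α} :
    x ∈ M.faceClosure A ↔ x ∈ M.ground ∧ ∀ F, M.IsFace F → A ⊆ F → x ∈ F := by
  classical
  simp [faceClosure]

theorem isFace_faceClosure (M : OrientedMatroid α) (A : Finset α) :
    M.IsFace (M.faceClosure A) := by
  have key : ∀ x ∈ M.ground, x ∉ M.faceClosure A → ∃ F, M.IsFace F ∧ A ⊆ F ∧ x ∉ F := by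
    intro x hx h
    simpa [mem_faceClosure, hx] using h
  have mono : ∀ F, M.IsFace F → A ⊆ F → M.faceClosure A ⊆ F := by
    intro F hF hA x hx
    exact ((M.mem_faceClosure).mp hx).2 F hF hA
  rw [isFace_iff]
  refine ⟨fun x hx => ((M.mem_faceClosure).mp hx).1, fun c hc => ⟨?_, ?_⟩⟩
  all_goals
    rintro ⟨x, hx⟩
    simp only [Finset.mem_inter, Finset.mem_sdiff] at hx
    obtain ⟨F, hF, hA, hxF⟩ := key x hx.2.1 hx.2.2
    have h := ((isFace_iff M F).mp hF).2 c hc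
  · obtain ⟨y, hy⟩ := h.mp ⟨x, by simp [hx, hxF]⟩
    simp only [Finset.mem_inter, Finset.mem_sdiff] at hy
    have hyc : y ∉ M.faceClosure A := fun h' => hy.2.2 (mono F hF hA h')
    exact ⟨y, by simp [hy, hyc]⟩
  · obtain ⟨y, hy⟩ := h.mpr ⟨x, by simp [hx, hxF]⟩
    simp only [Finset.mem_inter, Finset.mem_sdiff] at hy
    have hyc : y ∉ M.faceClosure A := fun h' => hy.2.2 (mono F hF hA h')
    exact ⟨y, by simp [hy, hyc]⟩

theorem faceClosure_subset (M : OrientedMatroid α) {A F : Finset α} (hF : M.IsFace F)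
    (hA : A ⊆ F) : M.faceClosure A ⊆ F := by
  intro x hx
  exact ((M.mem_faceClosure).mp hx).2 F hF hA

theorem subset_faceClosure (M : OrientedMatroid α) {A : Finset α} (hA : A ⊆ M.ground) :
    A ⊆ M.faceClosure A := by
  intro x hx
  exact (M.mem_faceClosure).mpr ⟨hA hx, fun F _ h => h hx⟩

theorem isFace_ground (M : OrientedMatroid α) : M.IsFace M.ground := by
  rw [isFace_iff]
  simp

theorem isFace_inter (M : OrientedMatroid α) {F G : Finset α} (hF : M.IsFace F)
    (hG : M.IsFace G) : M.IsFace (F ∩ G) := by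
  have h : M.faceClosure (F ∩ G) = F ∩ G :=
    (Finset.subset_inter (M.faceClosure_subset hF Finset.inter_subset_left)
      (M.faceClosure_subset hG Finset.inter_subset_right)).antisymm
      (M.subset_faceClosure (Finset.inter_subset_left.trans hF.1))
  rw [← h]
  exact M.isFace_faceClosure _

noncomputable instance (M : OrientedMatroid α) : Lattice M.FaceLattice where
  sup F G := ⟨M.faceClosure (F.1 ∪ G.1), M.isFace_faceClosure _⟩
  inf F G := ⟨F.1 ∩ G.1, M.isFace_inter F.2 G.2⟩
  le_sup_left F G := Finset.subset_union_left.trans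
    (M.subset_faceClosure (Finset.union_subset F.2.1 G.2.1))
  le_sup_right F G := Finset.subset_union_right.trans
    (M.subset_faceClosure (Finset.union_subset F.2.1 G.2.1))
  sup_le _ _ H h₁ h₂ := M.faceClosure_subset H.2 (Finset.union_subset h₁ h₂)
  inf_le_left _ _ := Finset.inter_subset_left
  inf_le_right _ _ := Finset.inter_subset_right
  le_inf _ _ _ h₁ h₂ := Finset.subset_inter h₁ h₂

noncomputable instance (M : OrientedMatroid α) : BoundedOrder M.FaceLattice where
  top := ⟨M.ground, M.isFace_ground⟩
  le_top F := F.2.1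
  bot := ⟨M.faceClosure ∅, M.isFace_faceClosure ∅⟩
  bot_le F := M.faceClosure_subset F.2 (Finset.empty_subset _)

instance (M : OrientedMatroid α) : Finite M.FaceLattice :=
  Set.Finite.subset (Finset.finite_toSet M.ground.powerset)
    (fun _ hF => Finset.mem_coe.mpr (Finset.mem_powerset.mpr hF.1))

end OrientedMatroid

/-! ### Building sets and nested sets -/

/-- The connected components of a building set: its maximal elements. -/
def maxElements {P : Type*} [PartialOrder P] (B : Set P) : Set P := {b | Maximal (· ∈ B) b}

section Lattice

variable {L : Type*} [Lattice L] [BoundedOrder L] [Finite L]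

open Classical in
/-- `B` is an `L`-building set: `⊥ ∉ B` and, for every `Y ≠ ⊥`, the interval `[⊥, Y]` is the
product of the intervals `[⊥, X]`, for `X` maximal in `B` below `Y`, through an isomorphism whose
component at each `X` is the inclusion of `[⊥, X]` in `[⊥, Y]`. -/
def IsLatticeBuildingSet (B : Set L) : Prop :=
  ⊥ ∉ B ∧ ∀ Y : L, Y ≠ ⊥ →
    ∃ φ : ((X : maxElements {b | b ∈ B ∧ b ≤ Y}) → Set.Iic (X : L)) ≃o Set.Iic Y,
      ∀ (X : maxElements {b | b ∈ B ∧ b ≤ Y}) (x : Set.Iic (X : L)),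
        (φ (Function.update ⊥ X x) : L) = (x : L)

/-- `N` is an `L`-nested set on `B`. -/
def IsLatticeNestedSet (B N : Set L) : Prop :=
  maxElements B ⊆ N ∧ N ⊆ B ∧
    ∀ s : Finset L, (s : Set L) ⊆ N \ maxElements B → 2 ≤ s.card →
      IsAntichain (· ≤ ·) (s : Set L) → s.sup id ∉ B

/-- The `L`-nested complex of `B`, as its set of faces. -/
def latticeNestedComplex (B : Set L) : Set (Set L) :=
  {S | ∃ N, IsLatticeNestedSet B N ∧ S = N \ maxElements B}

end Lattice

section Boolean

variable {α : Type*} [DecidableEq α]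

/-- `B` is a building set on the ground set `E`. -/
structure IsBuildingSet (E : Finset α) (B : Set (Finset α)) : Prop where
  subset_ground : ∀ b ∈ B, b ⊆ E
  nonempty : ∀ b ∈ B, b.Nonempty
  singleton_mem : ∀ s ∈ E, {s} ∈ B
  union_mem : ∀ b ∈ B, ∀ b' ∈ B, (b ∩ b').Nonempty → b ∪ b' ∈ B

/-- `N` is a nested set on the building set `B`. -/
structure IsNestedSet (B N : Set (Finset α)) : Prop where
  subset_building : N ⊆ B
  components_subset : maxElements B ⊆ N
  laminar : ∀ b ∈ N, ∀ b' ∈ N, b ⊆ b' ∨ b' ⊆ b ∨ Disjoint b b'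
  union_notMem : ∀ s : Finset (Finset α), (s : Set (Finset α)) ⊆ N → 2 ≤ s.card →
    (s : Set (Finset α)).Pairwise Disjoint → s.biUnion id ∉ B

/-- `(B, M)` is an oriented building set: `B` is a building set on the ground set of `M`
containing the supports of all circuits of `M`. -/
def IsOrientedBuildingSet (B : Set (Finset α)) (M : OrientedMatroid α) : Prop :=
  IsBuildingSet M.ground B ∧ ∀ c ∈ M.circuits, c.supp ∈ B

open Classical in
/-- The union of all elements of `N` strictly contained in `b`. -/
noncomputable def unionBelow (N : Set (Finset α)) (b : Finset α) : Finset α :=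
  b.filter fun x => ∃ C ∈ N, C ⊂ b ∧ x ∈ C

/-- `N` is acyclic for `M`: for every `b ∈ N`, contracting in the restriction of `M` to `b` the
union of the elements of `N` strictly contained in `b` gives an acyclic oriented matroid. -/
def IsAcyclicFor (N : Set (Finset α)) (M : OrientedMatroid α) : Prop :=
  ∀ b ∈ N, ((M.restrict b).contract (unionBelow N b)).Acyclic

/-- The acyclic nested complex of `(B, M)`, as its set of faces. -/
def acyclicNestedComplex (B : Set (Finset α)) (M : OrientedMatroid α) : Set (Set (Finset α)) :=
  {S | ∃ N, IsNestedSet B N ∧ IsAcyclicFor N M ∧ S = N \ maxElements B}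

/-- The facial part `B ∩ FL(M)`, as a subset of the face lattice. -/
def facialPart (B : Set (Finset α)) (M : OrientedMatroid α) : Set M.FaceLattice :=
  {F | F.1 ∈ B}

/-- `(F, M)` is a facial building set. -/
def IsFacialBuildingSet (M : OrientedMatroid α) (F : Set M.FaceLattice) : Prop :=
  IsLatticeBuildingSet F

/-- The facial nested complex of `(F, M)`: the nested complex of `F` over the face lattice. -/
def facialNestedComplex (M : OrientedMatroid α) (F : Set M.FaceLattice) :
    Set (Set M.FaceLattice) :=
  latticeNestedComplex F

end Boolean

/-!
The proof rests on describing faces by circuits: a set `F` is a face exactly when every circuit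
whose positive part lies in `F` has its negative part in `F` too (`isFace_iff_pos_subset`). When `M`
is acyclic, positive parts of circuits are nonempty, so the face closure of `A` is obtained from `A`
by repeatedly adding supports of circuits that meet the set reached so far. Supports of circuits
being blocks, the face closure of a block is a block (`IsOrientedBuildingSet.faceClosure_mem`).

It follows that the maximal facial blocks `X` below a face `Y` partition `Y`, and that every circuit
inside `Y` lies in one of them. Hence choosing a face in each `X` amounts to choosing a face below
`Y`: take the union, or conversely intersect with each `X`. This is the building set property.

Both kinds of nested sets consist of faces whose unions are again faces
(`IsNestedSet.isFace_biUnion`, `IsLatticeNestedSet.isFace_biUnion`). For an acyclic nested set, a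
circuit `c` with positive part in such a union is examined in the smallest block containing its
support. For a facial nested set, a circuit violating the face condition would glue the blocks that
it meets into a block whose closure is a forbidden join. Once unions are faces, joins are unions, so
the two prohibitions of joins and of unions agree; and the contraction at a block `b` is acyclic
because the union `R` of the smaller blocks is a face of `M`, so that the covector `(S ∖ R, ∅)`
restricts to `(b ∖ R, ∅)`.
-/

/-! ### Faces and circuits -/

namespace OrientedMatroid

variable {α : Type*} [DecidableEq α] (M : OrientedMatroid α)

theorem supp_subset_ground {c : SignedSubset α} (hc : c ∈ M.circuits) : c.supp ⊆ M.ground := by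
  rw [M.circuits_eq] at hc
  have h := hc.1
  rw [M.vectors_eq] at h
  exact h.1

theorem supp_nonempty {c : SignedSubset α} (hc : c ∈ M.circuits) : c.supp.Nonempty := by
  rw [M.circuits_eq] at hc
  exact hc.2.1

theorem isFace_iff_pos_subset (F : Finset α) :
    M.IsFace F ↔ F ⊆ M.ground ∧ ∀ c ∈ M.circuits, c.pos ⊆ F → c.neg ⊆ F := by
  rw [M.isFace_iff]
  refine and_congr_right fun _ => ⟨fun h c hc hp x hx => ?_, fun h c hc => ?_⟩
  · by_contra hxF
    have hxg : x ∈ M.ground := M.supp_subset_ground hc (Finset.mem_union_right _ hx)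
    obtain ⟨y, hy⟩ := (h c hc).mpr ⟨x, by simp [hx, hxF, hxg]⟩
    simp only [Finset.mem_inter, Finset.mem_sdiff] at hy
    exact hy.2.2 (hp hy.1)
  · have key : ∀ d ∈ M.circuits,
        (d.neg ∩ (M.ground \ F)).Nonempty → (d.pos ∩ (M.ground \ F)).Nonempty := by
      rintro d hd ⟨x, hx⟩
      simp only [Finset.mem_inter, Finset.mem_sdiff] at hx
      obtain ⟨y, hy, hyF⟩ := Finset.not_subset.mp fun hp => hx.2.2 (h d hd hp hx.1)
      have hyg : y ∈ M.ground := M.supp_subset_ground hd (Finset.mem_union_left _ hy)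
      exact ⟨y, by simp [hy, hyF, hyg]⟩
    exact ⟨key c.opp (M.opp_mem c hc), key c hc⟩

variable {M}

theorem neg_subset_of_isFace {F : Finset α} (hF : M.IsFace F) {c : SignedSubset α}
    (hc : c ∈ M.circuits) (hp : c.pos ⊆ F) : c.neg ⊆ F :=
  ((M.isFace_iff_pos_subset F).mp hF).2 c hc hp

theorem supp_subset_of_isFace {F : Finset α} (hF : M.IsFace F) {c : SignedSubset α}
    (hc : c ∈ M.circuits) (hp : c.pos ⊆ F) : c.supp ⊆ F :=
  Finset.union_subset hp (neg_subset_of_isFace hF hc hp)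

theorem isFace_empty (hM : M.Acyclic) : M.IsFace ∅ :=
  ⟨Finset.empty_subset _, by simpa [SignedSystem.Acyclic] using hM⟩

theorem pos_nonempty (hM : M.Acyclic) {c : SignedSubset α} (hc : c ∈ M.circuits) :
    c.pos.Nonempty := by
  rw [Finset.nonempty_iff_ne_empty]
  intro h
  have hs := supp_subset_of_isFace (isFace_empty hM) hc (by simp [h])
  exact (M.supp_nonempty hc).ne_empty (Finset.subset_empty.mp hs)

theorem faceClosure_eq {F : Finset α} (hF : M.IsFace F) : M.faceClosure F = F :=
  (M.faceClosure_subset hF le_rfl).antisymm (M.subset_faceClosure hF.1)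

theorem coe_bot_faceLattice (hM : M.Acyclic) : (⊥ : M.FaceLattice).1 = ∅ :=
  faceClosure_eq (isFace_empty hM)

theorem coe_finsetSup (s : Finset M.FaceLattice) :
    (s.sup id).1 = M.faceClosure (s.biUnion Subtype.val) := by
  apply Finset.Subset.antisymm
  · have h : s.sup id ≤ (⟨_, M.isFace_faceClosure (s.biUnion Subtype.val)⟩ : M.FaceLattice) := by
      refine Finset.sup_le fun F hF => ?_
      exact (Finset.subset_biUnion_of_mem Subtype.val hF).trans
        (M.subset_faceClosure (Finset.biUnion_subset.mpr fun G _ => G.2.1))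
    exact h
  · refine M.faceClosure_subset (s.sup id).2 (Finset.biUnion_subset.mpr fun F hF => ?_)
    exact Finset.le_sup (f := id) hF

end OrientedMatroid

/-! ### Building sets -/

section Building

variable {α : Type*} [DecidableEq α] {E : Finset α} {B : Set (Finset α)}

theorem IsBuildingSet.finite (hB : IsBuildingSet E B) : B.Finite :=
  (Finset.finite_toSet E.powerset).subset fun b hb =>
    Finset.mem_coe.mpr (Finset.mem_powerset.mpr (hB.subset_ground b hb))

theorem IsBuildingSet.exists_maxElements (hB : IsBuildingSet E B) {b : Finset α} (hb : b ∈ B) :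
    ∃ K ∈ maxElements B, b ⊆ K := by
  obtain ⟨K, hbK, hK⟩ := hB.finite.exists_le_maximal hb
  exact ⟨K, hK, hbK⟩

theorem IsBuildingSet.subset_of_maxElements (hB : IsBuildingSet E B) {b K : Finset α} (hb : b ∈ B)
    (hK : K ∈ maxElements B) (h : (b ∩ K).Nonempty) : b ⊆ K :=
  Finset.subset_union_left.trans (hK.2 (hB.union_mem b hb K hK.1 h) Finset.subset_union_right)

/-- A block glues together all the blocks that it meets. -/
theorem IsBuildingSet.union_biUnion_mem {ι : Type*} (hB : IsBuildingSet E B) {A : Finset α}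
    (hA : A ∈ B) (s : Finset ι) (f : ι → Finset α) (hs : ∀ i ∈ s, f i ∈ B ∧ (f i ∩ A).Nonempty) :
    A ∪ s.biUnion f ∈ B := by
  classical
  induction s using Finset.induction_on with
  | empty => simpa using hA
  | insert i s _ ih =>
    have h := ih fun j hj => hs j (Finset.mem_insert_of_mem hj)
    obtain ⟨hi, hiA⟩ := hs i (Finset.mem_insert_self _ _)
    have hU : A ∪ (insert i s).biUnion f = f i ∪ (A ∪ s.biUnion f) := by
      rw [Finset.biUnion_insert, Finset.union_left_comm]
    rw [hU]
    exact hB.union_mem _ hi _ h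
      (hiA.mono (Finset.inter_subset_inter_left Finset.subset_union_left))

variable {M : OrientedMatroid α}

/-- Blocks are stable under face closure: a maximal block between `A` and its face closure absorbs
every circuit with positive part inside it, hence is a face. -/
theorem IsOrientedBuildingSet.faceClosure_mem (hM : M.Acyclic) (hB : IsOrientedBuildingSet B M)
    {A : Finset α} (hA : A ∈ B) : M.faceClosure A ∈ B := by
  have hAg : A ⊆ M.ground := hB.1.subset_ground A hA
  obtain ⟨A', hAA', hmax⟩ := (hB.1.finite.subset
    (Set.sep_subset B fun b => b ⊆ M.faceClosure A)).exists_le_maximal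
      (a := A) ⟨hA, M.subset_faceClosure hAg⟩
  have hface : M.IsFace A' := by
    refine (M.isFace_iff_pos_subset A').mpr
      ⟨hB.1.subset_ground A' hmax.1.1, fun c hc hp => ?_⟩
    have hne : (A' ∩ c.supp).Nonempty := (OrientedMatroid.pos_nonempty hM hc).mono
      (Finset.subset_inter hp Finset.subset_union_left)
    have hsub : c.supp ⊆ M.faceClosure A := OrientedMatroid.supp_subset_of_isFace
      (M.isFace_faceClosure A) hc (hp.trans hmax.1.2)
    have hle := hmax.2 (y := A' ∪ c.supp) ⟨hB.1.union_mem _ hmax.1.1 _ (hB.2 c hc) hne,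
      Finset.union_subset hmax.1.2 hsub⟩ Finset.subset_union_left
    exact (Finset.subset_union_right.trans Finset.subset_union_right).trans hle
  have : M.faceClosure A = A' := (M.faceClosure_subset hface hAA').antisymm hmax.1.2
  rw [this]
  exact hmax.1.1

theorem IsOrientedBuildingSet.supp_subset_of_maxElements (hB : IsOrientedBuildingSet B M)
    {K : Finset α} (hK : K ∈ maxElements B) {c : SignedSubset α} (hc : c ∈ M.circuits)
    (h : (c.supp ∩ K).Nonempty) : c.supp ⊆ K :=
  hB.1.subset_of_maxElements (hB.2 c hc) hK h

theorem IsOrientedBuildingSet.isFace_of_maxElements (hM : M.Acyclic)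
    (hB : IsOrientedBuildingSet B M) {K : Finset α} (hK : K ∈ maxElements B) : M.IsFace K := by
  refine (M.isFace_iff_pos_subset K).mpr ⟨hB.1.subset_ground K hK.1, fun c hc hp => ?_⟩
  exact Finset.subset_union_right.trans (hB.supp_subset_of_maxElements hK hc
    ((OrientedMatroid.pos_nonempty hM hc).mono (Finset.subset_inter Finset.subset_union_left hp)))

/-- The connected components of the facial part are those of the building set. -/
theorem IsOrientedBuildingSet.mem_maxElements_facialPart (hM : M.Acyclic)
    (hB : IsOrientedBuildingSet B M) (X : M.FaceLattice) :
    X ∈ maxElements (facialPart B M) ↔ X.1 ∈ maxElements B := by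
  constructor
  · intro hX
    obtain ⟨K, hK, hXK⟩ := hB.1.exists_maxElements hX.1
    have hle : K ⊆ X.1 := hX.2 (y := ⟨K, hB.isFace_of_maxElements hM hK⟩) hK.1 hXK
    rwa [hXK.antisymm hle]
  · exact fun hX => ⟨hX.1, fun Y hY hXY => hX.2 hY hXY⟩

/-! ### The facial part is a lattice building set -/

/-- Every block inside a face `Y` lies in a maximal facial block below `Y`. -/
theorem IsOrientedBuildingSet.exists_maxElements_facialPart_le (hM : M.Acyclic)
    (hB : IsOrientedBuildingSet B M) {Y : M.FaceLattice} {A : Finset α} (hA : A ∈ B)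
    (hAY : A ⊆ Y.1) :
    ∃ X ∈ maxElements {b | b ∈ facialPart B M ∧ b ≤ Y}, A ⊆ X.1 := by
  let C : M.FaceLattice := ⟨M.faceClosure A, M.isFace_faceClosure A⟩
  have hC : C ∈ {b | b ∈ facialPart B M ∧ b ≤ Y} :=
    ⟨hB.faceClosure_mem hM hA, M.faceClosure_subset Y.2 hAY⟩
  obtain ⟨X, hCX, hX⟩ := (Set.toFinite _).exists_le_maximal hC
  exact ⟨X, hX, (M.subset_faceClosure (hB.1.subset_ground A hA)).trans hCX⟩

theorem IsOrientedBuildingSet.eq_of_maxElements_facialPart_le (hM : M.Acyclic)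
    (hB : IsOrientedBuildingSet B M) {Y X X' : M.FaceLattice}
    (hX : X ∈ maxElements {b | b ∈ facialPart B M ∧ b ≤ Y})
    (hX' : X' ∈ maxElements {b | b ∈ facialPart B M ∧ b ≤ Y}) {x : α} (hx : x ∈ X.1)
    (hx' : x ∈ X'.1) : X = X' := by
  obtain ⟨Z, hZ, hXZ⟩ := hB.exists_maxElements_facialPart_le hM (Y := Y)
    (hB.1.union_mem _ hX.1.1 _ hX'.1.1 ⟨x, by simp [hx, hx']⟩)
    (Finset.union_subset hX.1.2 hX'.1.2)
  have h : X ≤ Z := Finset.subset_union_left.trans hXZ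
  have h' : X' ≤ Z := Finset.subset_union_right.trans hXZ
  exact (hX.eq_of_le hZ.1 h).trans (hX'.eq_of_le hZ.1 h').symm

theorem IsOrientedBuildingSet.isFacialBuildingSet (hM : M.Acyclic)
    (hB : IsOrientedBuildingSet B M) : IsFacialBuildingSet M (facialPart B M) := by
  classical
  refine ⟨fun h => ?_, fun Y _ => ?_⟩
  · have h' : (⊥ : M.FaceLattice).1 ∈ B := h
    rw [OrientedMatroid.coe_bot_faceLattice hM] at h'
    exact Finset.not_nonempty_empty (hB.1.nonempty _ h')
  let K := maxElements {b | b ∈ facialPart B M ∧ b ≤ Y}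
  have : Fintype K := Fintype.ofFinite K
  have hKY : ∀ X : K, X.1.1 ⊆ Y.1 := fun X => X.2.1.2
  -- The union of a face of each component is a face, as each circuit of `Y` is in one component.
  have hface : ∀ f : (X : K) → Set.Iic (X : M.FaceLattice),
      M.IsFace (Finset.univ.biUnion fun X : K => (f X).1.1) := by
    intro f
    have hfX : ∀ X : K, (f X).1.1 ⊆ X.1.1 := fun X => (f X).2
    refine (M.isFace_iff_pos_subset _).mpr
      ⟨Finset.biUnion_subset.mpr fun X _ => (f X).1.2.1, fun c hc hp => ?_⟩
    have hcY : c.supp ⊆ Y.1 := OrientedMatroid.supp_subset_of_isFace Y.2 hc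
      (hp.trans (Finset.biUnion_subset.mpr fun X _ => (hfX X).trans (hKY X)))
    obtain ⟨X, hX, hcX⟩ := hB.exists_maxElements_facialPart_le hM (hB.2 c hc) hcY
    have hpX : c.pos ⊆ (f ⟨X, hX⟩).1.1 := by
      intro x hx
      obtain ⟨X', -, hxX'⟩ := Finset.mem_biUnion.mp (hp hx)
      have : X' = ⟨X, hX⟩ := Subtype.ext (hB.eq_of_maxElements_facialPart_le hM X'.2 hX
        (hfX X' hxX') (hcX (Finset.mem_union_left _ hx)))
      rwa [this] at hxX'
    exact (OrientedMatroid.neg_subset_of_isFace (f ⟨X, hX⟩).1.2 hc hpX).trans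
      (Finset.subset_biUnion_of_mem (fun X : K => (f X).1.1) (Finset.mem_univ _))
  have hinter : ∀ (f : (X : K) → Set.Iic (X : M.FaceLattice)) (X : K),
      (Finset.univ.biUnion fun X : K => (f X).1.1) ∩ X.1.1 = (f X).1.1 := by
    intro f X
    ext x
    simp only [Finset.mem_inter, Finset.mem_biUnion, Finset.mem_univ, true_and]
    constructor
    · rintro ⟨⟨X', hx⟩, hxX⟩
      have : X' = X := Subtype.ext
        (hB.eq_of_maxElements_facialPart_le hM X'.2 X.2 ((f X').2 hx) hxX)
      rwa [this] at hx
    · exact fun hx => ⟨⟨X, hx⟩, (f X).2 hx⟩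
  let φ : ((X : K) → Set.Iic (X : M.FaceLattice)) ≃o Set.Iic Y :=
    { toFun := fun f => ⟨⟨_, hface f⟩,
        Finset.biUnion_subset.mpr fun X _ => Finset.Subset.trans (f X).2 (hKY X)⟩
      invFun := fun G X => ⟨G.1 ⊓ X.1, Set.mem_Iic.mpr inf_le_right⟩
      left_inv := fun f => by
        funext X
        exact Subtype.ext (Subtype.ext (hinter f X))
      right_inv := fun G => by
        refine Subtype.ext (Subtype.ext ?_)
        apply Finset.Subset.antisymm
        · exact Finset.biUnion_subset.mpr fun X _ => Finset.inter_subset_left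
        · intro x hx
          obtain ⟨X, hX, hxX⟩ := hB.exists_maxElements_facialPart_le hM (Y := Y)
            (hB.1.singleton_mem x (G.1.2.1 hx))
            (Finset.singleton_subset_iff.mpr (G.2 hx))
          exact Finset.mem_biUnion.mpr ⟨⟨X, hX⟩, Finset.mem_univ _,
            Finset.mem_inter.mpr ⟨hx, Finset.singleton_subset_iff.mp hxX⟩⟩
      map_rel_iff' := by
        intro f g
        constructor
        · intro h X
          have h' := Finset.inter_subset_inter_right (u := X.1.1) h
          change (Finset.univ.biUnion fun X : K => (f X).1.1) ∩ X.1.1 ⊆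
            (Finset.univ.biUnion fun X : K => (g X).1.1) ∩ X.1.1 at h'
          rw [hinter, hinter] at h'
          exact h'
        · exact fun h => Finset.biUnion_mono fun X _ => h X }
  -- Any instance of decidable equality is allowed, to match the one in the building set property.
  have hφ : ∀ (_ : DecidableEq K) (X : K) (x : Set.Iic (X : M.FaceLattice)),
      (φ (Function.update ⊥ X x) : M.FaceLattice) = (x : M.FaceLattice) := by
    intro _ X x
    refine Subtype.ext ?_
    apply Finset.Subset.antisymm
    · refine Finset.biUnion_subset.mpr fun X' _ => ?_
      by_cases hXX : X' = X
      · subst hXX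
        rw [Function.update_self]
      · rw [Function.update_of_ne hXX]
        change (⊥ : M.FaceLattice).1 ⊆ _
        rw [OrientedMatroid.coe_bot_faceLattice hM]
        exact Finset.empty_subset _
    · intro a ha
      refine Finset.mem_biUnion.mpr ⟨X, Finset.mem_univ _, ?_⟩
      rwa [Function.update_self]
  exact ⟨φ, hφ _⟩

/-! ### Acyclic nested sets consist of faces -/

theorem mem_unionBelow {β : Type*} {N : Set (Finset β)} {b : Finset β} {x : β} :
    x ∈ unionBelow N b ↔ ∃ C ∈ N, C ⊂ b ∧ x ∈ C := by
  simp only [unionBelow, Finset.mem_filter, and_iff_right_iff_imp]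
  rintro ⟨C, -, hC, hx⟩
  exact hC.1 hx

/-- A block covered by the elements of a nested set strictly below `b` lies in one of them. -/
theorem IsNestedSet.exists_subset_of_subset_unionBelow {N : Set (Finset α)}
    (hB : IsBuildingSet E B) (hN : IsNestedSet B N) {A b : Finset α} (hA : A ∈ B)
    (h : A ⊆ unionBelow N b) : ∃ C ∈ N, C ⊂ b ∧ A ⊆ C := by
  classical
  have hfin : {C | C ∈ N ∧ C ⊂ b}.Finite := hB.finite.subset fun C hC => hN.subset_building hC.1
  let T : Set (Finset α) := {C | Maximal (· ∈ {C | C ∈ N ∧ C ⊂ b}) C ∧ (C ∩ A).Nonempty}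
  have hT : T.Finite := hfin.subset fun C hC => hC.1.1
  have hcov : A ⊆ hT.toFinset.biUnion id := by
    intro x hx
    obtain ⟨C, hC, hCb, hxC⟩ := mem_unionBelow.mp (h hx)
    obtain ⟨D, hCD, hD⟩ := hfin.exists_le_maximal (a := C) ⟨hC, hCb⟩
    exact Finset.mem_biUnion.mpr ⟨D, hT.mem_toFinset.mpr
      ⟨hD, x, Finset.mem_inter.mpr ⟨hCD hxC, hx⟩⟩, hCD hxC⟩
  have hmem : hT.toFinset.biUnion id ∈ B := by
    rw [← Finset.union_eq_right.mpr hcov]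
    refine hB.union_biUnion_mem hA _ id fun C hC => ?_
    have hC' := hT.mem_toFinset.mp hC
    exact ⟨hN.subset_building hC'.1.1.1, hC'.2⟩
  have hcard : hT.toFinset.card ≤ 1 := by
    by_contra! hlt
    refine hN.union_notMem hT.toFinset (fun C hC => ?_) hlt (fun C hC D hD hne => ?_) hmem
    · exact ((hT.mem_toFinset.mp hC).1.1).1
    · have hC' := (hT.mem_toFinset.mp hC).1
      have hD' := (hT.mem_toFinset.mp hD).1
      rcases hN.laminar C hC'.1.1 D hD'.1.1 with hle | hle | hdisj
      · exact absurd (hC'.eq_of_le hD'.1 hle) hne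
      · exact absurd (hD'.eq_of_le hC'.1 hle).symm hne
      · exact hdisj
  obtain ⟨x, hx⟩ := hB.nonempty A hA
  obtain ⟨C, hC, -⟩ := Finset.mem_biUnion.mp (hcov hx)
  refine ⟨C, (hT.mem_toFinset.mp hC).1.1.1, (hT.mem_toFinset.mp hC).1.1.2, fun y hy => ?_⟩
  obtain ⟨D, hD, hyD⟩ := Finset.mem_biUnion.mp (hcov hy)
  rwa [Finset.card_le_one.mp hcard D hD C hC] at hyD

theorem IsAcyclicFor.neg_subset_unionBelow {N : Set (Finset α)} (hN : IsAcyclicFor N M)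
    {b : Finset α} (hb : b ∈ N) {c : SignedSubset α} (hc : c ∈ M.circuits) (hcb : c.supp ⊆ b)
    (hp : c.pos ⊆ unionBelow N b) : c.neg ⊆ unionBelow N b := by
  obtain ⟨⟨v, hv, hvb⟩, -⟩ := hN b hb
  have hpos : v.pos ∩ b = b \ unionBelow N b := congrArg SignedSubset.pos hvb
  have hneg : v.neg ∩ b = ∅ := congrArg SignedSubset.neg hvb
  rw [M.covectors_eq] at hv
  have horth := hv.2 c hc
  intro x hx
  by_contra hxR
  have hxb : x ∈ b := hcb (Finset.mem_union_right _ hx)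
  have hxv : x ∈ v.pos ∩ b := by rw [hpos]; exact Finset.mem_sdiff.mpr ⟨hxb, hxR⟩
  obtain ⟨y, hy⟩ := horth.mpr ⟨x, Finset.mem_union_right _
    (Finset.mem_inter.mpr ⟨hx, (Finset.mem_inter.mp hxv).1⟩)⟩
  rcases Finset.mem_union.mp hy with hy | hy
  · obtain ⟨hyc, hyv⟩ := Finset.mem_inter.mp hy
    have hyb : y ∈ v.pos ∩ b :=
      Finset.mem_inter.mpr ⟨hyv, hcb (Finset.mem_union_left _ hyc)⟩
    rw [hpos] at hyb
    exact (Finset.mem_sdiff.mp hyb).2 (hp hyc)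
  · obtain ⟨hyc, hyv⟩ := Finset.mem_inter.mp hy
    have hyb : y ∈ v.neg ∩ b :=
      Finset.mem_inter.mpr ⟨hyv, hcb (Finset.mem_union_right _ hyc)⟩
    rw [hneg] at hyb
    exact Finset.notMem_empty _ hyb

/-- Unions of elements of an acyclic nested set are faces. A circuit is examined in the smallest
element `b` of the nested set that contains its support: its support cannot be covered by the
elements strictly below `b`, so acyclicity at `b` forbids its positive part from being covered by
them. -/
theorem IsNestedSet.isFace_biUnion {N : Set (Finset α)}
    (hB : IsOrientedBuildingSet B M) (hN : IsNestedSet B N) (hacy : IsAcyclicFor N M)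
    (s : Finset (Finset α)) (hs : (s : Set (Finset α)) ⊆ N) : M.IsFace (s.biUnion id) := by
  refine (M.isFace_iff_pos_subset _).mpr ⟨Finset.biUnion_subset.mpr fun X hX =>
    hB.1.subset_ground X (hN.subset_building (hs hX)), fun c hc hp => ?_⟩
  obtain ⟨K, hK, hcK⟩ := hB.1.exists_maxElements (hB.2 c hc)
  have hfin : {b | b ∈ N ∧ c.supp ⊆ b}.Finite :=
    hB.1.finite.subset fun b hb => hN.subset_building hb.1
  obtain ⟨b, -, hb⟩ := hfin.exists_le_minimal (a := K) ⟨hN.components_subset hK, hcK⟩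
  have hcb : c.supp ⊆ b := hb.1.2
  by_cases hX : ∃ X ∈ s, b ⊆ X
  · obtain ⟨X, hXs, hbX⟩ := hX
    exact (Finset.subset_union_right.trans (hcb.trans hbX)).trans
      (Finset.subset_biUnion_of_mem id hXs)
  exfalso
  push Not at hX
  have hpR : c.pos ⊆ unionBelow N b := by
    intro x hx
    obtain ⟨X, hXs, hxX⟩ := Finset.mem_biUnion.mp (hp hx)
    rcases hN.laminar X (hs hXs) b hb.1.1 with hle | hle | hdisj
    · exact mem_unionBelow.mpr ⟨X, hs hXs, ⟨hle, hX X hXs⟩, hxX⟩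
    · exact absurd hle (hX X hXs)
    · exact absurd (hcb (Finset.mem_union_left _ hx)) (Finset.disjoint_left.mp hdisj hxX)
  have hsR : c.supp ⊆ unionBelow N b :=
    Finset.union_subset hpR (hacy.neg_subset_unionBelow hb.1.1 hc hcb hpR)
  obtain ⟨C, hC, hCb, hcC⟩ := hN.exists_subset_of_subset_unionBelow hB.1 (hB.2 c hc) hsR
  exact hCb.2 (hb.2 ⟨hC, hcC⟩ hCb.1)

theorem IsNestedSet.isFace {N : Set (Finset α)}
    (hB : IsOrientedBuildingSet B M) (hN : IsNestedSet B N) (hacy : IsAcyclicFor N M)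
    {b : Finset α} (hb : b ∈ N) : M.IsFace b := by
  simpa using hN.isFace_biUnion hB hacy {b} (by simpa using hb)

theorem IsNestedSet.isLatticeNestedSet {N : Set (Finset α)} (hM : M.Acyclic)
    (hB : IsOrientedBuildingSet B M) (hN : IsNestedSet B N) (hacy : IsAcyclicFor N M) :
    IsLatticeNestedSet (facialPart B M) {F : M.FaceLattice | F.1 ∈ N} := by
  classical
  refine ⟨fun X hX => hN.components_subset ((hB.mem_maxElements_facialPart hM X).mp hX),
    fun X hX => hN.subset_building hX, fun s hs hcard hanti hmem => ?_⟩
  have hsN : ((s.image Subtype.val : Finset (Finset α)) : Set (Finset α)) ⊆ N := by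
    intro X hX
    obtain ⟨F, hF, rfl⟩ := Finset.mem_image.mp (Finset.mem_coe.mp hX)
    exact (hs hF).1
  have hU : (s.sup id).1 = (s.image Subtype.val).biUnion id := by
    rw [OrientedMatroid.coe_finsetSup, Finset.image_biUnion]
    have hface := hN.isFace_biUnion hB hacy _ hsN
    rw [Finset.image_biUnion] at hface
    exact OrientedMatroid.faceClosure_eq hface
  refine hN.union_notMem _ hsN ?_ ?_ (hU ▸ hmem)
  · rwa [Finset.card_image_of_injective _ Subtype.val_injective]
  · intro X hX Y hY hne
    obtain ⟨F, hF, rfl⟩ := Finset.mem_image.mp (Finset.mem_coe.mp hX)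
    obtain ⟨G, hG, rfl⟩ := Finset.mem_image.mp (Finset.mem_coe.mp hY)
    have hFG : F ≠ G := fun h => hne (congrArg _ h)
    rcases hN.laminar F.1 (hs hF).1 G.1 (hs hG).1 with hle | hle | hdisj
    · exact absurd hle (hanti hF hG hFG)
    · exact absurd hle (hanti hG hF hFG.symm)
    · exact hdisj

/-! ### Facial nested sets are acyclic nested sets -/

/-- A block between the union and the join of an antichain has the join as its face closure, so it
would make the join a block, which facial nested sets forbid. -/
theorem IsLatticeNestedSet.not_subset_of_mem {N : Set M.FaceLattice} (hM : M.Acyclic)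
    (hB : IsOrientedBuildingSet B M) (hN : IsLatticeNestedSet (facialPart B M) N)
    {s : Finset M.FaceLattice} (hs : (s : Set M.FaceLattice) ⊆ N \ maxElements (facialPart B M))
    (hcard : 2 ≤ s.card) (hanti : IsAntichain (· ≤ ·) (s : Set M.FaceLattice)) {A : Finset α}
    (hA : A ∈ B) (hsA : s.biUnion Subtype.val ⊆ A) : ¬A ⊆ (s.sup id).1 := by
  intro hle
  refine hN.2.2 s hs hcard hanti ?_
  have h : (s.sup id).1 = M.faceClosure A := by
    apply Finset.Subset.antisymm
    · rw [OrientedMatroid.coe_finsetSup]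
      exact M.faceClosure_subset (M.isFace_faceClosure A)
        (hsA.trans (M.subset_faceClosure (hB.1.subset_ground A hA)))
    · exact M.faceClosure_subset (s.sup id).2 hle
  change (s.sup id).1 ∈ B
  rw [h]
  exact hB.faceClosure_mem hM hA

/-- Unions of elements of a facial nested set are faces: a circuit with positive part in the union
glues the maximal elements that it meets into a block whose face closure is their join, so there is
only one such element, which is a face. -/
theorem IsLatticeNestedSet.isFace_biUnion {N : Set M.FaceLattice} (hM : M.Acyclic)
    (hB : IsOrientedBuildingSet B M) (hN : IsLatticeNestedSet (facialPart B M) N)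
    (T : Finset M.FaceLattice) (hT : (T : Set M.FaceLattice) ⊆ N) :
    M.IsFace (T.biUnion Subtype.val) := by
  classical
  refine (M.isFace_iff_pos_subset _).mpr ⟨Finset.biUnion_subset.mpr fun X _ => X.2.1,
    fun c hc hp => ?_⟩
  let s : Finset M.FaceLattice :=
    T.filter fun X => Maximal (· ∈ T) X ∧ (X.1 ∩ c.supp).Nonempty
  have hsT : s ⊆ T := Finset.filter_subset _ _
  have hcov : c.pos ⊆ s.biUnion Subtype.val := by
    intro x hx
    obtain ⟨X, hX, hxX⟩ := Finset.mem_biUnion.mp (hp hx)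
    obtain ⟨Y, hXY, hY⟩ := T.finite_toSet.exists_le_maximal hX
    exact Finset.mem_biUnion.mpr ⟨Y, Finset.mem_filter.mpr ⟨hY.1, hY, x,
      Finset.mem_inter.mpr ⟨hXY hxX, Finset.mem_union_left _ hx⟩⟩, hXY hxX⟩
  by_cases hmax : ∃ K ∈ s, K ∈ maxElements (facialPart B M)
  · obtain ⟨K, hKs, hK⟩ := hmax
    have hcK := hB.supp_subset_of_maxElements ((hB.mem_maxElements_facialPart hM K).mp hK) hc
      (by rw [Finset.inter_comm]; exact (Finset.mem_filter.mp hKs).2.2)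
    exact (Finset.subset_union_right.trans hcK).trans
      (Finset.subset_biUnion_of_mem Subtype.val (hsT hKs))
  push Not at hmax
  have hcard : s.card ≤ 1 := by
    by_contra! hlt
    have hanti : IsAntichain (· ≤ ·) (s : Set M.FaceLattice) := fun X hX Y hY hne hle =>
      hne ((Finset.mem_filter.mp hX).2.1.eq_of_le (hsT hY) hle)
    have hsub : s.biUnion Subtype.val ⊆ (s.sup id).1 :=
      Finset.biUnion_subset.mpr fun X hX => Finset.le_sup (f := id) hX
    refine hN.not_subset_of_mem hM hB (fun X hX => ⟨hT (hsT hX), hmax X hX⟩) hlt hanti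
      (hB.1.union_biUnion_mem (hB.2 c hc) s Subtype.val fun X hX =>
        ⟨hN.2.1 (hT (hsT hX)), (Finset.mem_filter.mp hX).2.2⟩)
      Finset.subset_union_right (Finset.union_subset ?_ hsub)
    exact OrientedMatroid.supp_subset_of_isFace (s.sup id).2 hc (hcov.trans hsub)
  obtain ⟨x, hx⟩ := OrientedMatroid.pos_nonempty hM hc
  obtain ⟨X, hX, -⟩ := Finset.mem_biUnion.mp (hcov hx)
  have hpX : c.pos ⊆ X.1 := by
    intro y hy
    obtain ⟨Y, hY, hyY⟩ := Finset.mem_biUnion.mp (hcov hy)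
    rwa [Finset.card_le_one.mp hcard Y hY X hX] at hyY
  exact (OrientedMatroid.neg_subset_of_isFace X.2 hc hpX).trans
    (Finset.subset_biUnion_of_mem Subtype.val (hsT hX))

theorem IsLatticeNestedSet.isNestedSet {N : Set M.FaceLattice} (hM : M.Acyclic)
    (hB : IsOrientedBuildingSet B M) (hN : IsLatticeNestedSet (facialPart B M) N) :
    IsNestedSet B (Subtype.val '' N) := by
  classical
  refine ⟨?_, fun K hK => ?_, ?_, ?_⟩
  · rintro _ ⟨X, hX, rfl⟩
    exact hN.2.1 hX
  · exact ⟨⟨K, hB.isFace_of_maxElements hM hK⟩,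
      hN.1 ((hB.mem_maxElements_facialPart hM _).mpr hK), rfl⟩
  · rintro _ ⟨X, hX, rfl⟩ _ ⟨Y, hY, rfl⟩
    by_contra! hcon
    obtain ⟨hXY, hYX, hdisj⟩ := hcon
    have hne : (X.1 ∩ Y.1).Nonempty := Finset.not_disjoint_iff_nonempty_inter.mp hdisj
    have hXmax : X ∉ maxElements (facialPart B M) := fun h => hYX
      (hB.1.subset_of_maxElements (hN.2.1 hY) ((hB.mem_maxElements_facialPart hM X).mp h)
        (by rwa [Finset.inter_comm]))
    have hYmax : Y ∉ maxElements (facialPart B M) := fun h => hXY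
      (hB.1.subset_of_maxElements (hN.2.1 hX) ((hB.mem_maxElements_facialPart hM Y).mp h) hne)
    have hXneY : X ≠ Y := fun h => hXY (h ▸ Finset.Subset.refl _)
    refine hN.not_subset_of_mem hM hB (s := {X, Y}) ?_ (Finset.card_pair hXneY).ge ?_
      (hB.1.union_mem _ (hN.2.1 hX) _ (hN.2.1 hY) hne) ?_ ?_
    · intro Z hZ
      rcases Finset.mem_insert.mp (Finset.mem_coe.mp hZ) with rfl | hZ
      · exact ⟨hX, hXmax⟩
      · rw [Finset.mem_singleton.mp hZ]
        exact ⟨hY, hYmax⟩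
    · rw [Finset.coe_pair]
      rintro Z (rfl | rfl) W (rfl | rfl) hne
      exacts [absurd rfl hne, hXY, hYX, absurd rfl hne]
    · simp
    · exact Finset.union_subset (Finset.le_sup (f := id) (Finset.mem_insert_self X {Y}))
        (Finset.le_sup (f := id) (Finset.mem_insert_of_mem (Finset.mem_singleton_self Y)))
  · intro t ht hcard hdisj hmem
    have hne : ∀ X ∈ t, X.Nonempty := by
      intro X hX
      obtain ⟨F, hF, rfl⟩ := ht hX
      exact hB.1.nonempty _ (hN.2.1 hF)
    have hle : ∀ X ∈ t, ∀ Y ∈ t, X ⊆ Y → X = Y := by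
      intro X hX Y hY h
      by_contra hXY
      obtain ⟨x, hx⟩ := hne X hX
      exact Finset.disjoint_left.mp (hdisj hX hY hXY) hx (h hx)
    obtain ⟨s, rfl⟩ : ∃ s : Finset M.FaceLattice, t = s.image Subtype.val := by
      refine ⟨(Set.toFinite {F : M.FaceLattice | F.1 ∈ t}).toFinset, ?_⟩
      ext X
      simp only [Finset.mem_image, Set.Finite.mem_toFinset, Set.mem_ofPred_eq]
      constructor
      · intro hX
        obtain ⟨F, -, rfl⟩ := ht hX
        exact ⟨F, hX, rfl⟩
      · rintro ⟨F, hF, rfl⟩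
        exact hF
    have hsN : ∀ F ∈ s, F ∈ N := by
      intro F hF
      obtain ⟨G, hG, hGF⟩ := ht (Finset.mem_coe.mpr (Finset.mem_image_of_mem Subtype.val hF))
      rwa [← Subtype.ext hGF]
    have hU : (s.image Subtype.val).biUnion id = s.biUnion Subtype.val := by
      rw [Finset.image_biUnion]
      rfl
    refine hN.not_subset_of_mem hM hB (s := s) (fun F hF => ⟨hsN F hF, fun hK => ?_⟩) ?_ ?_ hmem
      hU.ge ?_
    · -- A component is the whole union, so no other element can be disjoint from it.
      have hFK := hB.1.subset_of_maxElements hmem ((hB.mem_maxElements_facialPart hM F).mp hK)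
      have hFt : F.1 ∈ s.image Subtype.val := Finset.mem_image_of_mem _ hF
      have hFU : F.1 ⊆ (s.image Subtype.val).biUnion id := Finset.subset_biUnion_of_mem id hFt
      obtain ⟨X, hX, hXF⟩ := Finset.exists_mem_ne hcard F.1
      refine hXF (hle X hX F.1 hFt ?_)
      refine (Finset.subset_biUnion_of_mem id hX).trans (hFK ?_)
      rw [Finset.inter_eq_right.mpr hFU]
      exact hne _ hFt
    · rwa [Finset.card_image_of_injective _ Subtype.val_injective] at hcard
    · exact fun F hF G hG hFG h => hFG (Subtype.ext
        (hle _ (Finset.mem_image_of_mem _ hF) _ (Finset.mem_image_of_mem _ hG) h))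
    · rw [hU]
      exact Finset.biUnion_subset.mpr fun X hX => Finset.le_sup (f := id) hX

theorem IsLatticeNestedSet.isAcyclicFor {N : Set M.FaceLattice} (hM : M.Acyclic)
    (hB : IsOrientedBuildingSet B M) (hN : IsLatticeNestedSet (facialPart B M) N) :
    IsAcyclicFor (Subtype.val '' N) M := by
  classical
  rintro _ ⟨b, hb, rfl⟩
  let R := unionBelow (Subtype.val '' N) b.1
  have hR : M.IsFace R := by
    have h := hN.isFace_biUnion hM hB
      (Set.toFinite {C : M.FaceLattice | C ∈ N ∧ C.1 ⊂ b.1}).toFinset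
      (fun C hC => ((Set.Finite.mem_toFinset _).mp hC).1)
    convert h using 1
    ext x
    simp only [R, mem_unionBelow, Finset.mem_biUnion, Set.Finite.mem_toFinset, Set.mem_ofPred_eq]
    constructor
    · rintro ⟨_, ⟨C, hC, rfl⟩, hCb, hx⟩
      exact ⟨C, ⟨hC, hCb⟩, hx⟩
    · rintro ⟨C, ⟨hC, hCb⟩, hx⟩
      exact ⟨_, ⟨C, hC, rfl⟩, hCb, hx⟩
  refine ⟨⟨SignedSubset.ofPos (M.ground \ R), hR.2, ?_⟩, ?_⟩
  · have hpos : (M.ground \ R) ∩ b.1 = b.1 \ R := by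
      rw [Finset.inter_comm, ← Finset.inter_sdiff_assoc, Finset.inter_eq_left.mpr b.2.1]
    exact SignedSubset.ext hpos (Finset.empty_inter _)
  · change ((b.1 \ R) ∪ ∅) ∩ R = ∅
    rw [Finset.union_empty, Finset.sdiff_inter_self]

end Building

/-- Faces of the facial nested complex are sets of faces of `M`; they are read as sets of subsets
of the ground set through the inclusion of the face lattice in the boolean lattice. -/
theorem mainTheorem2 {α : Type*} [DecidableEq α] (M : OrientedMatroid α) (hM : M.Acyclic)
    (B : Set (Finset α)) (hB : IsOrientedBuildingSet B M) :
    IsFacialBuildingSet M (facialPart B M) ∧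
      (fun N : Set M.FaceLattice => Subtype.val '' N) '' facialNestedComplex M (facialPart B M) =
        acyclicNestedComplex B M := by
  refine ⟨hB.isFacialBuildingSet hM, Set.Subset.antisymm ?_ ?_⟩
  · rintro _ ⟨_, ⟨N, hN, rfl⟩, rfl⟩
    refine ⟨Subtype.val '' N, hN.isNestedSet hM hB, hN.isAcyclicFor hM hB, ?_⟩
    ext X
    constructor
    · rintro ⟨F, ⟨hF, hmax⟩, rfl⟩
      exact ⟨⟨F, hF, rfl⟩, fun h => hmax ((hB.mem_maxElements_facialPart hM F).mpr h)⟩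
    · rintro ⟨⟨F, hF, rfl⟩, hmax⟩
      exact ⟨F, ⟨hF, fun h => hmax ((hB.mem_maxElements_facialPart hM F).mp h)⟩, rfl⟩
  · rintro _ ⟨N, hN, hacy, rfl⟩
    refine ⟨_, ⟨_, hN.isLatticeNestedSet hM hB hacy, rfl⟩, ?_⟩
    ext X
    constructor
    · rintro ⟨F, ⟨hF, hmax⟩, rfl⟩
      exact ⟨hF, fun h => hmax ((hB.mem_maxElements_facialPart hM F).mpr h)⟩
    · rintro ⟨hX, hmax⟩
      exact ⟨⟨X, hN.isFace hB hacy hX⟩,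
        ⟨hX, fun h => hmax ((hB.mem_maxElements_facialPart hM _).mp h)⟩, rfl⟩
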